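/- Let $n>1$, let $C\in\mathbb{R}^{n\times n}$ be symmetric positive semidefinite, let $A\in\mathbb{R}^{m\times n}$, $b\in\mathbb{R}^m$, and let $s$ be an integer with $0<s<n$ and $s\le \operatorname{rank}(C)$. Let $\operatorname{ldet}$ denote the natural logarithm of the determinant, with value $-\infty$ on singular positive semidefinite matrices, and let $\mathbf{e}$ be the all-ones vector. The constrained maximum-entropy sampling problem has optimal value $$z:=\max\{\operatorname{ldet} C[S(x),S(x)] : \mathbf{e}^\top x=s,\ x\in\{0,1\}^n,\ Ax\le b\},$$ where $S(x)$ is the support of $x$ and $C[S,S]$ is the principal submatrix of $C$ indexed by $S$. For $\Upsilon=(\gamma_1,\dots,\gamma_n)^\top$ with all $\gamma_i>0$ and $x\in[0,1]^n$, let $$f_{\mathrm{linx}}(x;\Upsilon):=\tfrac12\operatorname{ldet}\bigl(\operatorname{Diag}(\Upsilon)\,C\operatorname{Diag}(x)\,C\operatorname{Diag}(\Upsilon)+\operatorname{Diag}(\mathbf{e}-x)\bigr)-\sum_{i=1}^n x_i\log\gamma_i,$$ and define the g-scaled linx bound $$z_{\mathrm{linx}}(\Upsilon):=\max\{f_{\mathrm{linx}}(x;\Upsilon)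 : \mathbf{e}^\top x=s,\ 0\le x\le \mathbf{e},\ Ax\le b\}.$$ (Both values lie in $[-\infty,\infty)$; a maximum over an empty set is $-\infty$.) Both maxima are attained whenever the respective feasible region is nonempty, and: (i) $z\le z_{\mathrm{linx}}(\Upsilon)$ for every $\Upsilon\in\mathbb{R}^n_{++}$; (ii) for every $\Upsilon\in\mathbb{R}^n_{++}$, the function $x\mapsto f_{\mathrm{linx}}(x;\Upsilon)$ is concave (as an extended-real-valued function) on the feasible region $\{x:\mathbf{e}^\top x=s,\ 0\le x\le\mathbf{e},\ Ax\le b\}$; (iii) $z_{\mathrm{linx}}(\Upsilon)$ is convex in $\log\Upsilon$, i.e. the function $u\mapsto z_{\mathrm{linx}}(e^{u_1},\dots,e^{u_n})$ is convex (as an extended-real-valued function) on $\mathbb{R}^n$. -/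

import Mathlib

namespace Linx

/-- `ldet M`: the natural logarithm of the determinant, as an extended real number,
with value `-∞` when the determinant is zero. It is only applied to positive semidefinite
matrices, whose determinant is nonnegative. -/
noncomputable def ldet {ι : Type*} [Fintype ι] [DecidableEq ι] (M : Matrix ι ι ℝ) : EReal :=
  ENNReal.log (ENNReal.ofReal M.det)

/-- The feasible region of CMESP: the vectors `x ∈ {0,1}ⁿ` with `eᵀx = s` and `Ax ≤ b`. -/
def cmespRegion {m n : ℕ} (A : Matrix (Fin m) (Fin n) ℝ) (b : Fin m → ℝ) (s : ℕ) :
    Set (Fin n → ℝ) :=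
  {x | ∑ i, x i = (s : ℝ) ∧ (∀ i, x i = 0 ∨ x i = 1) ∧ ∀ j, A.mulVec x j ≤ b j}

open Classical in
/-- The objective function of CMESP: `ldet C[S(x), S(x)]`, where `S(x)` is the support of `x`. -/
noncomputable def cmespObj {n : ℕ} (C : Matrix (Fin n) (Fin n) ℝ) (x : Fin n → ℝ) : EReal :=
  ldet (C.submatrix (Subtype.val : {i // x i ≠ 0} → Fin n)
    (Subtype.val : {i // x i ≠ 0} → Fin n))

/-- The optimal value `z` of CMESP (equal to `-∞` when there is no feasible point). -/
noncomputable def zCMESP {m n : ℕ} (C : Matrix (Fin n) (Fin n) ℝ)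
    (A : Matrix (Fin m) (Fin n) ℝ) (b : Fin m → ℝ) (s : ℕ) : EReal :=
  sSup (cmespObj C '' cmespRegion A b s)

/-- The feasible region of the linx relaxation: `eᵀx = s`, `0 ≤ x ≤ e`, `Ax ≤ b`. -/
def linxRegion {m n : ℕ} (A : Matrix (Fin m) (Fin n) ℝ) (b : Fin m → ℝ) (s : ℕ) :
    Set (Fin n → ℝ) :=
  {x | ∑ i, x i = (s : ℝ) ∧ (∀ i, 0 ≤ x i ∧ x i ≤ 1) ∧ ∀ j, A.mulVec x j ≤ b j}

/-- The matrix `Diag(γ) C Diag(x) C Diag(γ) + Diag(e - x)`. -/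
def linxMatrix {n : ℕ} (C : Matrix (Fin n) (Fin n) ℝ) (γ x : Fin n → ℝ) :
    Matrix (Fin n) (Fin n) ℝ :=
  Matrix.diagonal γ * C * Matrix.diagonal x * C * Matrix.diagonal γ +
    Matrix.diagonal (fun i => 1 - x i)

/-- The g-scaled linx objective
`½ ldet(Diag(γ) C Diag(x) C Diag(γ) + Diag(e - x)) - ∑ᵢ xᵢ log γᵢ`. -/
noncomputable def fLinx {n : ℕ} (C : Matrix (Fin n) (Fin n) ℝ) (γ x : Fin n → ℝ) : EReal :=
  ((1 / 2 : ℝ) : EReal) * ldet (linxMatrix C γ x) -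
    ((∑ i, x i * Real.log (γ i) : ℝ) : EReal)

/-- The g-scaled linx bound (equal to `-∞` when there is no feasible point). -/
noncomputable def zLinx {m n : ℕ} (C : Matrix (Fin n) (Fin n) ℝ)
    (A : Matrix (Fin m) (Fin n) ℝ) (b : Fin m → ℝ) (s : ℕ) (γ : Fin n → ℝ) : EReal :=
  sSup (fLinx C γ '' linxRegion A b s)

/-- An extended-real-valued function is convex on `S` if its epigraph over `S` is convex. -/
def EConvexOn {E : Type*} [AddCommGroup E] [Module ℝ E] (S : Set E) (f : E → EReal) : Prop :=
  Convex ℝ {p : E × ℝ | p.1 ∈ S ∧ f p.1 ≤ (p.2 : EReal)}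

/-- An extended-real-valued function is concave on `S` if its hypograph over `S` is convex. -/
def EConcaveOn {E : Type*} [AddCommGroup E] [Module ℝ E] (S : Set E) (f : E → EReal) : Prop :=
  Convex ℝ {p : E × ℝ | p.1 ∈ S ∧ (p.2 : EReal) ≤ f p.1}

end Linx

/-! At a binary `x` with support `S`, `Diag(x)` and `Diag(e - x)` are complementary idempotents, so
the linx matrix is `L * Lᵀ` with `L` block triangular and `det L = (∏_{i∈S} γ i) * det C[S,S]`. Half
the log-determinant minus `∑ x i * log (γ i)` is then `ldet C[S,S]`, which gives (i).

For (ii), the linx matrix is affine in `x` and positive semidefinite on the box, and `log det` is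
concave (`log_det_concave`).

For (iii), fix `x` and put `γ = exp u`. Expanding the determinant in principal minors
(`det_add_diagonal`) gives a nonnegative combination of exponentials of linear forms in `u`. Its
logarithm is convex (`sum_mul_exp_le_exp`), and a supremum of convex functions is convex.

Comparisons with a real `r` are rewritten as comparisons of `det` with an exponential, which absorbs
the value `-∞`. -/

namespace Linx

open Matrix

/-! ### The extended log-determinant -/

section ldet

variable {ι : Type*} [Fintype ι] [DecidableEq ι]

theorem coe_le_ldet_iff (M : Matrix ι ι ℝ) (r : ℝ) :
    (r : EReal) ≤ ldet M ↔ Real.exp r ≤ M.det := by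
  rw [ldet, ENNReal.log_ofReal]
  split_ifs with h
  · simpa using h.trans_lt (Real.exp_pos r)
  · rw [EReal.coe_le_coe_iff, Real.le_log_iff_exp_le (not_le.1 h)]

theorem continuous_ldet : Continuous (ldet : Matrix ι ι ℝ → EReal) :=
  ENNReal.continuous_log.comp
    (ENNReal.continuous_ofReal.comp (continuous_id.matrix_det))

end ldet

/-! ### Concavity of the log-determinant -/

section determinants

open scoped MatrixOrder Matrix.Norms.L2Operator

variable {ι : Type*} [Fintype ι] [DecidableEq ι]

/-- Apply `log t ≤ t - 1` to each eigenvalue. -/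
theorem log_det_le_trace_sub_card {X : Matrix ι ι ℝ} (hX : X.PosDef) :
    Real.log X.det ≤ X.trace - Fintype.card ι := by
  rw [hX.1.det_eq_prod_eigenvalues, hX.1.trace_eq_sum_eigenvalues]
  simp only [RCLike.ofReal_real_eq_id, id_eq]
  rw [Real.log_prod (fun i _ => (hX.eigenvalues_pos i).ne')]
  calc ∑ i, Real.log (hX.1.eigenvalues i) ≤ ∑ i, (hX.1.eigenvalues i - 1) :=
        Finset.sum_le_sum fun i _ => Real.log_le_sub_one_of_pos (hX.eigenvalues_pos i)
    _ = _ := by simp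

/-- The tangent-plane inequality for `log det` at `Z`. Since `X * Z⁻¹` need not be symmetric, the
eigenvalue bound is applied to `Bᴴ * X * B` with `Z⁻¹ = B * Bᴴ`, which has the same trace and
determinant. -/
theorem log_det_sub_log_det_le {X Z : Matrix ι ι ℝ} (hX : X.PosDef) (hZ : Z.PosDef) :
    Real.log X.det - Real.log Z.det ≤ (X * Z⁻¹).trace - Fintype.card ι := by
  obtain ⟨B, hB, hZB⟩ : ∃ B : Matrix ι ι ℝ, IsUnit B ∧ Z⁻¹ = B * Bᴴ := by
    obtain ⟨B, hB, h⟩ := (CStarAlgebra.isStrictlyPositive_iff_eq_star_mul_self).1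
      hZ.inv.isStrictlyPositive
    exact ⟨star B, hB.star, by simpa [star_eq_conjTranspose] using h⟩
  have hP : (Bᴴ * X * B).PosDef :=
    hX.conjTranspose_mul_mul_same (mulVec_injective_iff_isUnit.2 hB)
  have key := log_det_le_trace_sub_card hP
  have htr : (Bᴴ * X * B).trace = (X * Z⁻¹).trace := by
    rw [hZB, Matrix.mul_assoc, trace_mul_comm, Matrix.mul_assoc]
  have hdet : (Bᴴ * X * B).det = X.det * Z.det⁻¹ := by
    have : Z⁻¹.det = Z.det⁻¹ := by rw [det_nonsing_inv, Ring.inverse_eq_inv']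
    rw [← this, hZB]
    simp only [det_mul]
    ring
  rw [htr, hdet, Real.log_mul hX.det_pos.ne' (inv_ne_zero hZ.det_pos.ne'), Real.log_inv] at key
  linarith

theorem log_det_concave {X Y : Matrix ι ι ℝ} (hX : X.PosDef) (hY : Y.PosDef) {a c : ℝ}
    (ha : 0 ≤ a) (hc : 0 ≤ c) (hac : a + c = 1) :
    (a • X + c • Y).PosDef ∧
      a * Real.log X.det + c * Real.log Y.det ≤ Real.log (a • X + c • Y).det := by
  have hZ : (a • X + c • Y).PosDef := by
    rcases ha.eq_or_lt with rfl | ha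
    · obtain rfl : c = 1 := by linarith
      simpa using hY
    · exact (hX.smul ha).add_posSemidef (hY.posSemidef.smul hc)
  refine ⟨hZ, ?_⟩
  set Z := a • X + c • Y with hZdef
  have h1 := mul_le_mul_of_nonneg_left (log_det_sub_log_det_le hX hZ) ha
  have h2 := mul_le_mul_of_nonneg_left (log_det_sub_log_det_le hY hZ) hc
  -- The weighted trace terms add up to `tr (Z * Z⁻¹)`, so the linear parts of the two tangent
  -- inequalities cancel.
  have h3 : a * (X * Z⁻¹).trace + c * (Y * Z⁻¹).trace = Fintype.card ι := by
    rw [← smul_eq_mul, ← smul_eq_mul (a := c), ← trace_smul, ← trace_smul, ← trace_add,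
      ← Matrix.smul_mul, ← Matrix.smul_mul, ← Matrix.add_mul, ← hZdef,
      mul_nonsing_inv _ ((isUnit_iff_isUnit_det _).1 hZ.isUnit), trace_one]
  obtain rfl : c = 1 - a := by linarith
  nlinarith

theorem exp_le_det_smul_add_smul {X Y : Matrix ι ι ℝ} (hX : X.PosSemidef) (hY : Y.PosSemidef)
    {a c p q : ℝ} (ha : 0 ≤ a) (hc : 0 ≤ c) (hac : a + c = 1)
    (hp : Real.exp p ≤ X.det) (hq : Real.exp q ≤ Y.det) :
    Real.exp (a * p + c * q) ≤ (a • X + c • Y).det := by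
  have hXd := (Real.exp_pos p).trans_le hp
  have hYd := (Real.exp_pos q).trans_le hq
  -- A positive determinant upgrades semidefinite to definite.
  have hX' : X.PosDef :=
    hX.posDef_iff_isUnit.2 ((isUnit_iff_isUnit_det _).2 (isUnit_iff_ne_zero.2 hXd.ne'))
  have hY' : Y.PosDef :=
    hY.posDef_iff_isUnit.2 ((isUnit_iff_isUnit_det _).2 (isUnit_iff_ne_zero.2 hYd.ne'))
  obtain ⟨hZ, h⟩ := log_det_concave hX' hY' ha hc hac
  rw [← Real.le_log_iff_exp_le hZ.det_pos]
  refine le_trans ?_ h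
  rw [← Real.le_log_iff_exp_le hXd] at hp
  rw [← Real.le_log_iff_exp_le hYd] at hq
  gcongr

end determinants

/-! ### Expansion of a determinant in principal minors -/

section principalMinors

variable {ι : Type*} [Fintype ι] [DecidableEq ι]

/-- Rows outside `S` vanish on the columns in `S`, so the matrix is block triangular. -/
theorem det_of_piecewise_diagonal (M : Matrix ι ι ℝ) (d : ι → ℝ) (S : Finset ι) :
    (of fun i j => if i ∈ S then M i j else diagonal d i j).det =
      (M.submatrix (Subtype.val : {i // i ∈ S} → ι) Subtype.val).det *
        ∏ i : {i // i ∉ S}, d i := by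
  rw [twoBlockTriangular_det _ (fun i => i ∈ S)]
  · have hS : toSquareBlockProp (of fun i j => if i ∈ S then M i j else diagonal d i j)
        (fun i => i ∈ S) = M.submatrix (Subtype.val : {i // i ∈ S} → ι) Subtype.val := by
      ext i j
      simp only [toSquareBlockProp, toBlock_apply, of_apply, submatrix_apply, if_pos i.2]
    have hT : toSquareBlockProp (of fun i j => if i ∈ S then M i j else diagonal d i j)
        (fun i => i ∉ S) = diagonal (fun i : {i // i ∉ S} => d i) := by
      ext i j
      simp only [toSquareBlockProp, toBlock_apply, of_apply, if_neg i.2, diagonal_apply, Subtype.ext_iff]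
    rw [hS, hT, det_diagonal]
    congr!
  · intro i hi j hj
    have : i ≠ j := by rintro rfl; exact hi hj
    simp [hi, diagonal_apply, this]

/-- Multilinearity in the rows: `S` records the rows taken from `M`. -/
theorem det_add_diagonal (M : Matrix ι ι ℝ) (d : ι → ℝ) :
    (M + diagonal d).det =
      ∑ S : Finset ι, (M.submatrix (Subtype.val : {i // i ∈ S} → ι) Subtype.val).det *
        ∏ i : {i // i ∉ S}, d i := by
  refine ((detRowAlternating (n := ι) (R := ℝ)).toMultilinearMap.map_add_univ
    (fun i => M i) (fun i => diagonal d i)).trans (Finset.sum_congr rfl fun S _ => ?_)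
  rw [← det_of_piecewise_diagonal]
  refine congrArg (detRowAlternating (n := ι) (R := ℝ)) ?_
  funext i j
  by_cases h : i ∈ S <;> simp [Finset.piecewise, h]

end principalMinors

/-- Convexity of log-sum-exp, in a form that allows all weights to vanish. Once both bounds are
normalized to `1`, convexity of `exp` applied term by term suffices. -/
theorem sum_mul_exp_le_exp {α E : Type*} [AddCommGroup E] [Module ℝ E] (T : Finset α) (w : α → ℝ)
    (hw : ∀ k ∈ T, 0 ≤ w k) (l : α → E →ₗ[ℝ] ℝ) {u v : E} {a c p q : ℝ}
    (ha : 0 ≤ a) (hc : 0 ≤ c) (hac : a + c = 1)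
    (hp : ∑ k ∈ T, w k * Real.exp (l k u) ≤ Real.exp p)
    (hq : ∑ k ∈ T, w k * Real.exp (l k v) ≤ Real.exp q) :
    ∑ k ∈ T, w k * Real.exp (l k (a • u + c • v)) ≤ Real.exp (a * p + c * q) := by
  have normalize : ∀ (x : E) (r : ℝ), ∑ k ∈ T, w k * Real.exp (l k x) ≤ Real.exp r →
      ∑ k ∈ T, w k * Real.exp (l k x - r) ≤ 1 := by
    intro x r h
    simp only [Real.exp_sub, ← mul_div_assoc]
    rwa [← Finset.sum_div, div_le_one (Real.exp_pos _)]
  have hp' := mul_le_mul_of_nonneg_left (normalize u p hp) ha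
  have hq' := mul_le_mul_of_nonneg_left (normalize v q hq) hc
  have h : ∑ k ∈ T, w k * Real.exp (l k (a • u + c • v) - (a * p + c * q)) ≤ 1 := by
    calc _ ≤ ∑ k ∈ T, (a * (w k * Real.exp (l k u - p)) + c * (w k * Real.exp (l k v - q))) := by
          refine Finset.sum_le_sum fun k hk => ?_
          have h := convexOn_exp.2 (Set.mem_univ (l k u - p)) (Set.mem_univ (l k v - q)) ha hc hac
          simp only [smul_eq_mul] at h
          have e : l k (a • u + c • v) - (a * p + c * q)
              = a * (l k u - p) + c * (l k v - q) := by
            simp only [map_add, map_smul, smul_eq_mul]; ring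
          rw [e]
          linarith [mul_le_mul_of_nonneg_left h (hw k hk)]
      _ ≤ 1 := by
          rw [Finset.sum_add_distrib, ← Finset.mul_sum, ← Finset.mul_sum]
          linarith
  simp only [Real.exp_sub, ← mul_div_assoc] at h
  rwa [← Finset.sum_div, div_le_one (Real.exp_pos _)] at h

/-! ### The linx objective and bound -/

section linx

variable {m n : ℕ} {C : Matrix (Fin n) (Fin n) ℝ}

theorem fLinx_eq_bot {γ x : Fin n → ℝ} (h : (linxMatrix C γ x).det ≤ 0) :
    fLinx C γ x = ⊥ := by
  rw [fLinx, ldet, ENNReal.log_ofReal, if_pos h, EReal.coe_mul_bot_of_pos (by norm_num),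
    EReal.bot_sub]

theorem fLinx_eq_coe {γ x : Fin n → ℝ} (h : 0 < (linxMatrix C γ x).det) :
    fLinx C γ x = ((1 / 2 * Real.log (linxMatrix C γ x).det -
      ∑ i, x i * Real.log (γ i) : ℝ) : EReal) := by
  rw [fLinx, ldet, ENNReal.log_ofReal_of_pos h, EReal.coe_sub, EReal.coe_mul]

theorem coe_le_fLinx_iff (γ x : Fin n → ℝ) (r : ℝ) :
    (r : EReal) ≤ fLinx C γ x ↔
      Real.exp (2 * (r + ∑ i, x i * Real.log (γ i))) ≤ (linxMatrix C γ x).det := by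
  rcases le_or_gt (linxMatrix C γ x).det 0 with h | h
  · rw [fLinx_eq_bot h]
    simpa using h.trans_lt (Real.exp_pos _)
  · rw [fLinx_eq_coe h, EReal.coe_le_coe_iff, ← Real.le_log_iff_exp_le h]
    constructor <;> intro h <;> linarith

theorem fLinx_le_coe_iff (γ x : Fin n → ℝ) (r : ℝ) :
    fLinx C γ x ≤ (r : EReal) ↔
      (linxMatrix C γ x).det ≤ Real.exp (2 * (r + ∑ i, x i * Real.log (γ i))) := by
  rcases le_or_gt (linxMatrix C γ x).det 0 with h | h
  · rw [fLinx_eq_bot h]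
    simpa using h.trans (Real.exp_pos _).le
  · rw [fLinx_eq_coe h, EReal.coe_le_coe_iff, ← Real.log_le_iff_le_exp h]
    constructor <;> intro h <;> linarith

theorem linxMatrix_posSemidef (hC : C.PosSemidef) (γ : Fin n → ℝ) {x : Fin n → ℝ}
    (hx : ∀ i, 0 ≤ x i ∧ x i ≤ 1) : (linxMatrix C γ x).PosSemidef := by
  refine PosSemidef.add ?_ (PosSemidef.diagonal fun i => sub_nonneg.2 (hx i).2)
  have h := (PosSemidef.diagonal (n := Fin n) (d := x)
    fun i => (hx i).1).mul_mul_conjTranspose_same (diagonal γ * C)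
  simpa [-conjTranspose_eq_transpose_of_trivial, conjTranspose_mul, hC.1.eq, diagonal_conjTranspose, Matrix.mul_assoc] using h

theorem linxMatrix_smul_add_smul (γ x y : Fin n → ℝ) {a c : ℝ} (hac : a + c = 1) :
    linxMatrix C γ (a • x + c • y) = a • linxMatrix C γ x + c • linxMatrix C γ y := by
  have h1 : diagonal (a • x + c • y) = a • diagonal x + c • diagonal y := by
    rw [← diagonal_smul, ← diagonal_smul, diagonal_add]; rfl
  have h2 : diagonal (fun i => 1 - (a • x + c • y) i)
      = a • diagonal (fun i => 1 - x i) + c • diagonal (fun i => 1 - y i) := by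
    rw [← diagonal_smul, ← diagonal_smul, diagonal_add]
    congr 1
    ext i
    simp only [Pi.add_apply, Pi.smul_apply, smul_eq_mul]
    linear_combination -hac
  simp only [linxMatrix, h1, h2, Matrix.mul_add, Matrix.add_mul, Matrix.mul_smul,
    Matrix.smul_mul, smul_add]
  abel

theorem convex_linxRegion (A : Matrix (Fin m) (Fin n) ℝ) (b : Fin m → ℝ) (s : ℕ) :
    Convex ℝ (linxRegion A b s) := by
  rintro x ⟨hx1, hx2, hx3⟩ y ⟨hy1, hy2, hy3⟩ a c ha hc hac
  refine ⟨?_, fun i => ⟨?_, ?_⟩, fun j => ?_⟩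
  · simp only [Pi.add_apply, Pi.smul_apply, smul_eq_mul]
    rw [Finset.sum_add_distrib, ← Finset.mul_sum, ← Finset.mul_sum, hx1, hy1, ← add_mul, hac,
      one_mul]
  · exact add_nonneg (mul_nonneg ha (hx2 i).1) (mul_nonneg hc (hy2 i).1)
  · calc a * x i + c * y i ≤ a * 1 + c * 1 := by gcongr; exacts [(hx2 i).2, (hy2 i).2]
      _ = 1 := by linarith
  · rw [mulVec_add, mulVec_smul, mulVec_smul]
    calc a * A.mulVec x j + c * A.mulVec y j ≤ a * b j + c * b j := by
          gcongr; exacts [hx3 j, hy3 j]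
      _ = b j := by rw [← add_mul, hac, one_mul]

theorem isCompact_linxRegion (A : Matrix (Fin m) (Fin n) ℝ) (b : Fin m → ℝ) (s : ℕ) :
    IsCompact (linxRegion A b s) := by
  refine (isCompact_univ_pi fun _ : Fin n => isCompact_Icc (a := (0 : ℝ)) (b := 1)).of_isClosed_subset
    ?_ fun x hx i _ => hx.2.1 i
  have h1 : IsClosed {x : Fin n → ℝ | ∑ i, x i = (s : ℝ)} :=
    isClosed_eq (by fun_prop) continuous_const
  have h2 : IsClosed {x : Fin n → ℝ | ∀ i, 0 ≤ x i ∧ x i ≤ 1} := by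
    simp only [Set.ofPred_forall]
    exact isClosed_iInter fun i => (isClosed_le continuous_const (continuous_apply i)).inter
      (isClosed_le (continuous_apply i) continuous_const)
  have h3 : IsClosed {x : Fin n → ℝ | ∀ j, A.mulVec x j ≤ b j} := by
    simp only [Set.ofPred_forall]
    exact isClosed_iInter fun j => isClosed_le
      ((continuous_apply j).comp (continuous_const.matrix_mulVec continuous_id)) continuous_const
  exact h1.inter (h2.inter h3)

theorem finite_cmespRegion (A : Matrix (Fin m) (Fin n) ℝ) (b : Fin m → ℝ) (s : ℕ) :
    (cmespRegion A b s).Finite :=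
  (Set.Finite.pi' fun _ : Fin n => Set.toFinite ({0, 1} : Set ℝ)).subset
    fun _ hx i => by simpa using hx.2.1 i

theorem cmespRegion_subset_linxRegion (A : Matrix (Fin m) (Fin n) ℝ) (b : Fin m → ℝ) (s : ℕ) :
    cmespRegion A b s ⊆ linxRegion A b s := fun x hx =>
  ⟨hx.1, fun i => by rcases hx.2.1 i with h | h <;> simp [h], hx.2.2⟩

/-- Holds across singular matrices too: the factor `1/2` is finite and nonzero and the subtracted
sum is real, so the discontinuities of `EReal` arithmetic are avoided. -/
theorem continuous_fLinx (C : Matrix (Fin n) (Fin n) ℝ) (γ : Fin n → ℝ) :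
    Continuous (fLinx C γ) := by
  have hM : Continuous fun x => ldet (linxMatrix C γ x) := by
    refine continuous_ldet.comp ?_
    unfold linxMatrix
    fun_prop
  have hmul : Continuous fun x => ((1 / 2 : ℝ) : EReal) * ldet (linxMatrix C γ x) := by
    refine continuous_iff_continuousAt.2 fun x => ?_
    have hne : ((1 / 2 : ℝ) : EReal) ≠ 0 := by
      rw [Ne, EReal.coe_eq_zero]; norm_num
    exact ContinuousAt.comp (f := fun x => (((1 / 2 : ℝ) : EReal), ldet (linxMatrix C γ x)))
      (g := fun p : EReal × EReal => p.1 * p.2)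
      (EReal.continuousAt_mul (.inl hne) (.inl hne) (.inl (EReal.coe_ne_bot _))
        (.inl (EReal.coe_ne_top _)))
      (continuousAt_const.prodMk hM.continuousAt)
  have hsum : Continuous fun x : Fin n → ℝ =>
      ((-(∑ i, x i * Real.log (γ i)) : ℝ) : EReal) :=
    continuous_coe_real_ereal.comp (by fun_prop)
  refine continuous_iff_continuousAt.2 fun x => ?_
  exact ContinuousAt.comp
    (f := fun x => (((1 / 2 : ℝ) : EReal) * ldet (linxMatrix C γ x),
      ((-(∑ i, x i * Real.log (γ i)) : ℝ) : EReal)))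
    (g := fun p : EReal × EReal => p.1 + p.2)
    (EReal.continuousAt_add (.inr (EReal.coe_ne_bot _)) (.inr (EReal.coe_ne_top _)))
    (hmul.prodMk hsum).continuousAt

theorem concaveOn_fLinx (hC : C.PosSemidef) (A : Matrix (Fin m) (Fin n) ℝ) (b : Fin m → ℝ)
    (s : ℕ) (γ : Fin n → ℝ) : EConcaveOn (linxRegion A b s) (fun x => fLinx C γ x) := by
  rintro ⟨x, r⟩ ⟨hx, hr⟩ ⟨y, t⟩ ⟨hy, ht⟩ a c ha hc hac
  refine ⟨convex_linxRegion A b s hx hy ha hc hac, ?_⟩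
  simp only [coe_le_fLinx_iff] at hr ht
  simp only [Prod.smul_mk, Prod.mk_add_mk, coe_le_fLinx_iff]
  rw [linxMatrix_smul_add_smul γ x y hac]
  convert exp_le_det_smul_add_smul (linxMatrix_posSemidef hC γ hx.2.1)
    (linxMatrix_posSemidef hC γ hy.2.1) ha hc hac hr ht using 2
  have hsum : ∑ i, (a • x + c • y) i * Real.log (γ i)
      = a * ∑ i, x i * Real.log (γ i) + c * ∑ i, y i * Real.log (γ i) := by
    rw [Finset.mul_sum, Finset.mul_sum, ← Finset.sum_add_distrib]
    refine Finset.sum_congr rfl fun i _ => ?_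
    simp only [Pi.add_apply, Pi.smul_apply, smul_eq_mul]
    ring
  rw [hsum]
  simp only [smul_eq_mul]
  ring

theorem exists_det_linxMatrix_exp_eq_sum (hC : C.PosSemidef) {x : Fin n → ℝ}
    (hx : ∀ i, 0 ≤ x i ∧ x i ≤ 1) :
    ∃ (w : Finset (Fin n) → ℝ) (l : Finset (Fin n) → (Fin n → ℝ) →ₗ[ℝ] ℝ), (∀ S, 0 ≤ w S) ∧
      ∀ u : Fin n → ℝ, (linxMatrix C (fun i => Real.exp (u i)) x).det =
        ∑ S, w S * Real.exp (l S u) := by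
  have hpsd : (C * diagonal x * C).PosSemidef := by
    simpa [-conjTranspose_eq_transpose_of_trivial, hC.1.eq] using
      (PosSemidef.diagonal (n := Fin n) (d := x) fun i => (hx i).1).mul_mul_conjTranspose_same C
  -- The weights are principal minors of a semidefinite matrix times factors `1 - x i ≥ 0`. Scaling
  -- by `Diag(exp u)` on both sides multiplies the `S`-minor by `exp (2 * ∑_{i∈S} u i)`.
  refine ⟨fun S => ((C * diagonal x * C).submatrix
      (Subtype.val : {i // i ∈ S} → Fin n) Subtype.val).det * ∏ i : {i // i ∉ S}, (1 - x i),
    fun S => ∑ i : {i // i ∈ S}, (2 : ℝ) • LinearMap.proj (R := ℝ) (φ := fun _ => ℝ) (i : Fin n),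
    fun S => mul_nonneg (hpsd.submatrix _).det_nonneg
      (Finset.prod_nonneg fun i _ => sub_nonneg.2 (hx i).2), fun u => ?_⟩
  rw [linxMatrix, det_add_diagonal]
  refine Finset.sum_congr rfl fun S _ => ?_
  have h : (diagonal (fun i => Real.exp (u i)) * C * diagonal x * C *
      diagonal (fun i => Real.exp (u i))).submatrix (Subtype.val : {i // i ∈ S} → Fin n)
        Subtype.val =
      diagonal (fun i : {i // i ∈ S} => Real.exp (u i)) *
        (C * diagonal x * C).submatrix (Subtype.val : {i // i ∈ S} → Fin n) Subtype.val *
      diagonal (fun i : {i // i ∈ S} => Real.exp (u i)) := by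
    ext i j
    rw [Matrix.mul_assoc (diagonal _) C, Matrix.mul_assoc (diagonal _) (C * diagonal x)]
    simp only [submatrix_apply, mul_diagonal, diagonal_mul]
  have h2 : Real.exp ((∑ i : {i // i ∈ S}, (2 : ℝ) •
      LinearMap.proj (R := ℝ) (φ := fun _ => ℝ) (i : Fin n)) u)
      = (∏ i : {i // i ∈ S}, Real.exp (u i)) * ∏ i : {i // i ∈ S}, Real.exp (u i) := by
    simp only [LinearMap.sum_apply, LinearMap.smul_apply, LinearMap.proj_apply, smul_eq_mul]
    rw [Real.exp_sum, ← Finset.prod_mul_distrib]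
    exact Finset.prod_congr rfl fun i _ => by rw [← Real.exp_add, two_mul]
  rw [h, h2, det_mul, det_mul, det_diagonal]
  ring

theorem convex_fLinx_exp (hC : C.PosSemidef) {x : Fin n → ℝ} (hx : ∀ i, 0 ≤ x i ∧ x i ≤ 1) :
    EConvexOn Set.univ (fun u : Fin n → ℝ => fLinx C (fun i => Real.exp (u i)) x) := by
  obtain ⟨w, l, hw, h⟩ := exists_det_linxMatrix_exp_eq_sum hC hx
  rintro ⟨u, r⟩ ⟨-, hr⟩ ⟨v, t⟩ ⟨-, ht⟩ a c ha hc hac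
  refine ⟨Set.mem_univ _, ?_⟩
  simp only [fLinx_le_coe_iff, Real.log_exp, h] at hr ht
  simp only [Prod.smul_mk, Prod.mk_add_mk, fLinx_le_coe_iff, Real.log_exp, h]
  convert sum_mul_exp_le_exp Finset.univ w (fun S _ => hw S) l ha hc hac hr ht using 2
  have hsum : ∑ i, x i * (a • u + c • v) i
      = a * ∑ i, x i * u i + c * ∑ i, x i * v i := by
    rw [Finset.mul_sum, Finset.mul_sum, ← Finset.sum_add_distrib]
    refine Finset.sum_congr rfl fun i _ => ?_
    simp only [Pi.add_apply, Pi.smul_apply, smul_eq_mul]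
    ring
  rw [hsum]
  simp only [smul_eq_mul]
  ring

theorem convex_zLinx_exp (hC : C.PosSemidef) (A : Matrix (Fin m) (Fin n) ℝ) (b : Fin m → ℝ)
    (s : ℕ) :
    EConvexOn Set.univ (fun u : Fin n → ℝ => zLinx C A b s (fun i => Real.exp (u i))) := by
  -- The epigraph of a supremum is the intersection of the epigraphs.
  have h : {p : (Fin n → ℝ) × ℝ | p.1 ∈ Set.univ ∧
        zLinx C A b s (fun i => Real.exp (p.1 i)) ≤ (p.2 : EReal)} =
      ⋂ x ∈ linxRegion A b s, {p : (Fin n → ℝ) × ℝ | p.1 ∈ Set.univ ∧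
        fLinx C (fun i => Real.exp (p.1 i)) x ≤ (p.2 : EReal)} := by
    ext p
    simp [zLinx, sSup_le_iff]
  unfold EConvexOn
  rw [h]
  exact convex_iInter₂ fun x hx => convex_fLinx_exp hC hx.2.1

open Classical in
theorem det_linxMatrix_of_binary (hC : C.PosSemidef) (γ : Fin n → ℝ) {x : Fin n → ℝ}
    (hx : ∀ i, x i = 0 ∨ x i = 1) :
    (linxMatrix C γ x).det =
      ((∏ i : {i // x i ≠ 0}, γ i) *
        (C.submatrix (Subtype.val : {i // x i ≠ 0} → Fin n) Subtype.val).det) ^ 2 := by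
  set L := diagonal γ * C * diagonal x + diagonal (fun i => 1 - x i) with hL
  have hfac : linxMatrix C γ x = L * Lᵀ := by
    have h1 : diagonal x * diagonal x = diagonal x := by
      rw [diagonal_mul_diagonal]; congr 1; ext i; rcases hx i with h | h <;> simp [h]
    have h2 : diagonal x * diagonal (fun i => 1 - x i) = 0 := by
      rw [diagonal_mul_diagonal, ← diagonal_zero]
      congr 1; ext i; rcases hx i with h | h <;> simp [h]
    have h3 : diagonal (fun i => 1 - x i) * diagonal x = 0 := by
      rw [diagonal_mul_diagonal, ← diagonal_zero]
      congr 1; ext i; rcases hx i with h | h <;> simp [h]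
    have h4 : diagonal (fun i => 1 - x i) * diagonal (fun i => 1 - x i)
        = diagonal (fun i => 1 - x i) := by
      rw [diagonal_mul_diagonal]; congr 1; ext i; rcases hx i with h | h <;> simp [h]
    have hCt : Cᵀ = C := by simpa using hC.1.eq
    rw [hL, linxMatrix, transpose_add, transpose_mul, transpose_mul, diagonal_transpose,
      diagonal_transpose, diagonal_transpose, hCt, Matrix.add_mul, Matrix.mul_add,
      Matrix.mul_add, h4]
    have e1 : diagonal γ * C * diagonal x * (diagonal x * (C * diagonal γ))
        = diagonal γ * C * (diagonal x * diagonal x) * C * diagonal γ := by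
      simp only [Matrix.mul_assoc]
    have e2 : diagonal γ * C * diagonal x * diagonal (fun i => 1 - x i) = 0 := by
      rw [Matrix.mul_assoc, h2, Matrix.mul_zero]
    have e3 : diagonal (fun i => 1 - x i) * (diagonal x * (C * diagonal γ)) = 0 := by
      rw [← Matrix.mul_assoc, h3, Matrix.zero_mul]
    rw [e1, e2, e3, h1, add_zero, zero_add]
  have hdet : L.det = (∏ i : {i // x i ≠ 0}, γ i) *
      (C.submatrix (Subtype.val : {i // x i ≠ 0} → Fin n) Subtype.val).det := by
    -- Columns of `L` outside the support are standard unit vectors.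
    rw [twoBlockTriangular_det' L (fun i => x i ≠ 0)]
    · have hS : toSquareBlockProp L (fun i => x i ≠ 0) =
          diagonal (fun i : {i // x i ≠ 0} => γ i) *
            C.submatrix (Subtype.val : {i // x i ≠ 0} → Fin n) Subtype.val := by
        ext i j
        have hi := (hx i).resolve_left i.2
        have hj := (hx j).resolve_left j.2
        simp [toSquareBlockProp, hL, diagonal_apply, hi, hj, diagonal_mul]
      have hT : toSquareBlockProp L (fun i => ¬ x i ≠ 0) = 1 := by
        ext i j
        have hi := not_not.1 i.2
        have hj := not_not.1 j.2
        simp [toSquareBlockProp, hL, diagonal_apply, hi, hj, one_apply, Subtype.ext_iff]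
      rw [hS, hT, det_one, mul_one, det_mul, det_diagonal]
    · intro i hi j hj
      have hij : i ≠ j := by rintro rfl; exact hj hi
      simp [hL, hij, not_not.1 hj]
  rw [hfac, det_mul, det_transpose, hdet, sq]

theorem cmespObj_le_fLinx (hC : C.PosSemidef) {γ : Fin n → ℝ} (hγ : ∀ i, 0 < γ i)
    {x : Fin n → ℝ} (hx : ∀ i, x i = 0 ∨ x i = 1) : cmespObj C x ≤ fLinx C γ x := by
  classical
  refine EReal.ge_of_forall_gt_iff_ge.1 fun r hr => ?_
  have hr := hr.le
  rw [cmespObj, coe_le_ldet_iff] at hr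
  rw [coe_le_fLinx_iff, det_linxMatrix_of_binary hC γ hx]
  have hsum : ∑ i, x i * Real.log (γ i) = ∑ i : {i // x i ≠ 0}, Real.log (γ i) := by
    rw [← Finset.sum_subtype (Finset.univ.filter fun i => x i ≠ 0) (by simp)
      fun i => Real.log (γ i), Finset.sum_filter]
    exact Finset.sum_congr rfl fun i _ => by rcases hx i with h | h <;> simp [h]
  have hexp : Real.exp (∑ i, x i * Real.log (γ i)) = ∏ i : {i // x i ≠ 0}, γ i := by
    rw [hsum, Real.exp_sum]
    exact Finset.prod_congr rfl fun i _ => Real.exp_log (hγ i)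
  -- Both sides become squares with the common factor `∏ γ i` over the support, leaving `exp r ≤ det
  -- C[S,S]`.
  rw [two_mul, Real.exp_add, ← sq, Real.exp_add, hexp, mul_comm (Real.exp r)]
  have hpos : 0 ≤ ∏ i : {i // x i ≠ 0}, γ i := Finset.prod_nonneg fun i _ => (hγ i).le
  have := (Real.exp_pos r).le
  gcongr

end linx

end Linx

theorem theorem2 {m n : ℕ} (C : Matrix (Fin n) (Fin n) ℝ) (hC : C.PosSemidef)
    (A : Matrix (Fin m) (Fin n) ℝ) (b : Fin m → ℝ)
    (s : ℕ) (hs0 : 0 < s) (hsn : s < n) (hrank : s ≤ C.rank) :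
    -- the two suprema are maxima as soon as there is a feasible point
    ((Linx.cmespRegion A b s).Nonempty →
      IsGreatest (Linx.cmespObj C '' Linx.cmespRegion A b s) (Linx.zCMESP C A b s)) ∧
    (∀ γ : Fin n → ℝ, (∀ i, 0 < γ i) → (Linx.linxRegion A b s).Nonempty →
      IsGreatest (Linx.fLinx C γ '' Linx.linxRegion A b s) (Linx.zLinx C A b s γ)) ∧
    -- (i) the linx bound is an upper bound
    (∀ γ : Fin n → ℝ, (∀ i, 0 < γ i) → Linx.zCMESP C A b s ≤ Linx.zLinx C A b s γ) ∧
    -- (ii) the objective is concave in `x` on the feasible region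
    (∀ γ : Fin n → ℝ, (∀ i, 0 < γ i) →
      Linx.EConcaveOn (Linx.linxRegion A b s) (fun x => Linx.fLinx C γ x)) ∧
    -- (iii) the bound is convex in `u = log γ`
    Linx.EConvexOn Set.univ
      (fun u : Fin n → ℝ => Linx.zLinx C A b s (fun i => Real.exp (u i))) := by

  refine ⟨fun hne => ?_, fun γ _ hne => ?_, fun γ hγ => ?_,
    fun γ _ => Linx.concaveOn_fLinx hC A b s γ, Linx.convex_zLinx_exp hC A b s⟩
  · have hfin := (Linx.finite_cmespRegion A b s).image (Linx.cmespObj C)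
    exact ⟨(hne.image _).csSup_mem hfin, fun _ hy => le_sSup hy⟩
  · exact ((Linx.isCompact_linxRegion A b s).image
      (Linx.continuous_fLinx C γ)).isGreatest_sSup (hne.image _)
  · refine sSup_le ?_
    rintro _ ⟨x, hx, rfl⟩
    exact (Linx.cmespObj_le_fLinx hC hγ hx.2.1).trans
      (le_sSup ⟨x, Linx.cmespRegion_subset_linxRegion A b s hx, rfl⟩)
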